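/- Conventions. For a topological space $X$, a continuous valuation on $X$ is a map $\mu$ from the open subsets of $X$ to $[0,\infty]$ that satisfies $\mu(\emptyset)=0$, is monotone, satisfies $\mu(U)+\mu(V)=\mu(U\cup V)+\mu(U\cap V)$, and preserves directed unions: $\mu(\bigcup_i U_i)=\sup_i\mu(U_i)$. Let $\mathcal V_wX$ be the set of continuous valuations on $X$ with the weak topology, generated by the sets $[U>r]=\{\mu\mid \mu(U)>r\}$ ($U$ open, $r\ge 0$), and with pointwise addition and multiplication by $r\in\mathbb R_+=[0,\infty)$. For lower semicontinuous $h\colon X\to[0,\infty]$ let $\int h\,d\mu=\int_0^\infty\mu(h^{-1}(r,\infty])\,dr$. The functor $\mathcal V_w$, acting on continuous maps by $\mathcal V_wf(\mu)(V)=\mu(f^{-1}(V))$, is a monad on the category $\mathbf{TOP}_0$ of $T_0$ spaces and continuous maps, with unit $x\mapsto\delta_x$ (Dirac mass) and multiplication $m_X(\varpi)(U)=\int_{\nu\in\mathcal V_wX}\nu(U)\,d\varpi$; this is the extended probabilistic powerdomain monad. A cone is a commutative monoid $(C,+,0)$ with a scalar multiplication $\mathbb R_+\times C\to C$ satisfying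 $r(x+y)=rx+ry$, $(r+s)x=rx+sx$, $(rs)x=r(sx)$, $1x=x$, $0x=0$, $r0=0$. A topological cone is a cone with a $T_0$ topology making $+$ and $\cdot$ jointly continuous, where $\mathbb R_+$ carries the Scott topology. A map $f$ between cones is linear if $f(rx+sy)=rf(x)+sf(y)$ for all $r,s\in\mathbb R_+$. A set $A\subseteq C$ is convex if $ra+(1-r)b\in A$ for $a,b\in A$, $r\in[0,1]$, and is a half-space if $A$ and its complement are convex. $C$ is weakly locally convex if every open neighbourhood of every point contains a convex (not necessarily open) neighbourhood of that point, and locally linear if it has a subbase of open half-spaces. A space is sober if every irreducible closed subset is the closure of a unique point. A linear retraction between topological cones is a continuous linear map that has a continuous (not necessarily linear) section. Proposition. Let $(X,\alpha)$ be an Eilenberg–Moore algebra of the monad $\mathcal V_w$ on $\mathbf{TOP}_0$. Then there is a cone structure on $X$ with $$x+y=\alpha(\delta_x+\delta_y),\qquad r\cdot x=\alpha(r\delta_x)\qquad(x,y\in X,\ r\in\mathbb R_+),$$ and with this structure $X$ is a weakly locally convex, sober topological cone and $\alpha\colon\mathcal V_wX\to X$ is linear. Moreover $\mathcal V_wX$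 is a locally linear, sober topological cone and $\alpha$ is a linear retraction, so that $X$ is a linear retract of $\mathcal V_wX$. -/

import Mathlib

open CategoryTheory TopologicalSpace MeasureTheory
open scoped NNReal ENNReal Topology

universe u

namespace ProbPowerdomain

noncomputable section

/-! ### Continuous valuations and the weak topology -/

/-- A continuous valuation on a topological space. -/
@[ext]
structure ContValuation (X : Type u) [TopologicalSpace X] where
  toFun : Opens X → ℝ≥0∞
  strict : toFun ⊥ = 0
  mono : ∀ U V : Opens X, U ≤ V → toFun U ≤ toFun V
  modular : ∀ U V : Opens X, toFun U + toFun V = toFun (U ⊔ V) + toFun (U ⊓ V)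
  scott : ScottContinuous toFun

variable {X Y Z : Type u} [TopologicalSpace X] [TopologicalSpace Y] [TopologicalSpace Z]

instance : FunLike (ContValuation X) (Opens X) ℝ≥0∞ where
  coe := ContValuation.toFun
  coe_injective _ _ h := ContValuation.ext h

lemma ContValuation.ext_opens {μ ν : ContValuation X} (h : ∀ U, μ U = ν U) : μ = ν :=
  DFunLike.ext _ _ h

/-- The weak topology, generated by the sets `[U > r] = {μ | μ U > r}`. -/
instance : TopologicalSpace (ContValuation X) :=
  TopologicalSpace.generateFrom
    {S | ∃ (U : Opens X) (r : ℝ≥0), S = {μ : ContValuation X | (r : ℝ≥0∞) < μ U}}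

lemma ContValuation.apply_bot (μ : ContValuation X) : μ ⊥ = 0 := μ.strict

lemma ContValuation.monotone (μ : ContValuation X) : Monotone μ := fun U V h => μ.mono U V h

lemma ContValuation.map_iSup (μ : ContValuation X) {ι : Type*} [Nonempty ι] (U : ι → Opens X)
    (hU : Directed (· ≤ ·) U) : μ (⨆ i, U i) = ⨆ i, μ (U i) := by
  have h := μ.scott (d := Set.range U) (Set.range_nonempty U) hU.directedOn_range
    (a := ⨆ i, U i) isLUB_iSup
  rw [← Set.range_comp] at h
  exact h.iSup_eq.symm

/-- Reduces Scott continuity to suprema of directed families. -/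
lemma scottContinuous_of_iSup {f : Opens X → ℝ≥0∞} (hm : Monotone f)
    (h : ∀ (d : Set (Opens X)), Nonempty d → Directed (· ≤ ·) (fun i : d => (i : Opens X)) →
      f (⨆ i : d, (i : Opens X)) ≤ ⨆ i : d, f i) : ScottContinuous f := by
  intro d hd hd' a ha
  have hne : Nonempty d := hd.to_subtype
  have ha' : a = ⨆ i : d, (i : Opens X) := by
    rw [← sSup_eq_iSup']; exact ha.sSup_eq.symm
  refine ⟨?_, ?_⟩
  · rintro _ ⟨U, hU, rfl⟩
    exact hm (ha.1 hU)
  · intro b hb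
    rw [ha']
    exact (h d hne hd'.directed_val).trans (iSup_le fun i => hb ⟨i, i.2, rfl⟩)

instance : T0Space (ContValuation X) := by
  refine ⟨fun μ ν h => ?_⟩
  have key : ∀ (μ ν : ContValuation X), Inseparable μ ν → ∀ U, μ U ≤ ν U := by
    intro μ ν h U
    refine ENNReal.le_of_forall_nnreal_lt fun r hr => ?_
    have ho : IsOpen {ρ : ContValuation X | (r : ℝ≥0∞) < ρ U} := .basic _ ⟨U, r, rfl⟩
    exact le_of_lt ((h.mem_open_iff ho).1 hr)
  exact ContValuation.ext_opens fun U => le_antisymm (key μ ν h U) (key ν μ h.symm U)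

lemma lowerSemicontinuous_eval (U : Opens X) :
    LowerSemicontinuous (fun μ : ContValuation X => μ U) := by
  rw [lowerSemicontinuous_iff_isOpen_preimage]
  intro a
  induction a with
  | top => simp
  | coe r => exact .basic _ ⟨U, r, rfl⟩

lemma continuous_of_lowerSemicontinuous {f : X → ContValuation Y}
    (h : ∀ U, LowerSemicontinuous (fun x => f x U)) : Continuous f := by
  refine continuous_generateFrom_iff.2 ?_
  rintro _ ⟨U, r, rfl⟩
  exact (h U).isOpen_preimage r

/-! ### Cone structure -/

instance : Zero (ContValuation X) where
  zero :=
    { toFun := fun _ => 0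
      strict := rfl
      mono := fun _ _ _ => le_rfl
      modular := fun _ _ => rfl
      scott := scottContinuous_of_iSup (fun _ _ _ => le_rfl) (fun _ _ _ => zero_le) }

instance : Add (ContValuation X) where
  add μ ν :=
    { toFun := fun U => μ U + ν U
      strict := by
        change μ.toFun ⊥ + ν.toFun ⊥ = 0
        rw [μ.strict, ν.strict, add_zero]
      mono := fun U V h => add_le_add (μ.mono U V h) (ν.mono U V h)
      modular := fun U V => by
        have h1 : μ U + μ V = μ (U ⊔ V) + μ (U ⊓ V) := μ.modular U V
        have h2 : ν U + ν V = ν (U ⊔ V) + ν (U ⊓ V) := ν.modular U V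
        rw [add_add_add_comm, h1, h2, add_add_add_comm]
      scott := by
        refine scottContinuous_of_iSup
          (fun U V h => add_le_add (μ.mono U V h) (ν.mono U V h)) ?_
        intro d hd hd'
        rw [μ.map_iSup _ hd', ν.map_iSup _ hd']
        refine le_of_eq (ENNReal.iSup_add_iSup fun i j => ?_)
        obtain ⟨k, hi, hj⟩ := hd' i j
        exact ⟨k, add_le_add (μ.monotone hi) (ν.monotone hj)⟩ }

instance : SMul ℝ≥0 (ContValuation X) where
  smul r μ :=
    { toFun := fun U => (r : ℝ≥0∞) * μ U
      strict := by
        change (r : ℝ≥0∞) * μ.toFun ⊥ = 0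
        rw [μ.strict, mul_zero]
      mono := fun U V h => mul_le_mul_right (μ.mono U V h) _
      modular := fun U V => by
        have h1 : μ U + μ V = μ (U ⊔ V) + μ (U ⊓ V) := μ.modular U V
        rw [← mul_add, h1, mul_add]
      scott := by
        refine scottContinuous_of_iSup (fun U V h => mul_le_mul_right (μ.mono U V h) _) ?_
        intro d hd hd'
        rw [μ.map_iSup _ hd', ENNReal.mul_iSup] }

@[simp] lemma ContValuation.zero_apply (U : Opens X) : (0 : ContValuation X) U = 0 := rfl

@[simp] lemma ContValuation.add_apply (μ ν : ContValuation X) (U : Opens X) :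
    (μ + ν) U = μ U + ν U := rfl

@[simp] lemma ContValuation.smul_apply (r : ℝ≥0) (μ : ContValuation X) (U : Opens X) :
    (r • μ) U = r * μ U := rfl

instance : AddCommMonoid (ContValuation X) where
  add_assoc _ _ _ := ContValuation.ext_opens fun _ => by simp [add_assoc]
  zero_add _ := ContValuation.ext_opens fun _ => by simp
  add_zero _ := ContValuation.ext_opens fun _ => by simp
  add_comm _ _ := ContValuation.ext_opens fun _ => by simp [add_comm]
  nsmul := nsmulRec

instance : Module ℝ≥0 (ContValuation X) where
  one_smul _ := ContValuation.ext_opens fun _ => by simp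
  mul_smul _ _ _ := ContValuation.ext_opens fun _ => by simp [mul_assoc]
  smul_zero _ := ContValuation.ext_opens fun _ => by simp
  smul_add _ _ _ := ContValuation.ext_opens fun _ => by simp [mul_add]
  add_smul _ _ _ := ContValuation.ext_opens fun _ => by simp [add_mul]
  zero_smul _ := ContValuation.ext_opens fun _ => by simp

/-! ### Dirac valuations and functoriality -/

open Classical in
/-- The Dirac mass at `x`. -/
def dirac (x : X) : ContValuation X where
  toFun U := if x ∈ U then 1 else 0
  strict := by simp
  mono U V h := by
    split_ifs with h1 h2
    · exact le_rfl
    · exact absurd (h h1) h2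
    · exact zero_le
    · exact le_rfl
  modular U V := by
    by_cases h1 : x ∈ U <;> by_cases h2 : x ∈ V <;> simp [h1, h2]
  scott := by
    refine scottContinuous_of_iSup ?_ ?_
    · intro U V h
      dsimp only
      split_ifs with h1 h2
      · exact le_rfl
      · exact absurd (h h1) h2
      · exact zero_le
      · exact le_rfl
    · intro d hd hd'
      split_ifs with h1
      · obtain ⟨i, hi⟩ := Opens.mem_iSup.1 h1
        exact le_iSup_of_le i (by simp [hi])
      · exact zero_le

open Classical in
lemma dirac_apply (x : X) (U : Opens X) : dirac x U = if x ∈ U then 1 else 0 := rfl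

/-- The push-forward `V f`. -/
def map (f : C(X, Y)) (μ : ContValuation X) : ContValuation Y where
  toFun V := μ (V.comap f)
  strict := μ.strict
  mono _ _ h := μ.mono _ _ (Opens.comap_mono f h)
  modular U V := μ.modular (U.comap f) (V.comap f)
  scott := by
    refine scottContinuous_of_iSup (fun U V h => μ.monotone (Opens.comap_mono f h)) ?_
    intro d hd hd'
    have h1 : Directed (· ≤ ·) (fun i : d => Opens.comap f (i : Opens Y)) :=
      fun i j => (hd' i j).imp fun _ hk =>
        ⟨Opens.comap_mono f hk.1, Opens.comap_mono f hk.2⟩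
    rw [← μ.map_iSup _ h1]
    refine μ.monotone fun x hx => ?_
    obtain ⟨i, hi⟩ := Opens.mem_iSup.1 (show f x ∈ ⨆ i : d, (i : Opens Y) from hx)
    exact Opens.mem_iSup.2 ⟨i, hi⟩

lemma map_apply (f : C(X, Y)) (μ : ContValuation X) (V : Opens Y) :
    map f μ V = μ (V.comap f) := rfl

/-! ### The Choquet integral -/

/-- The open set `h⁻¹ (r, ∞]` for a lower semicontinuous `h`. -/
def level (h : X → ℝ≥0∞) (hh : LowerSemicontinuous h) (r : ℝ) : Opens X :=
  ⟨{x | ENNReal.ofReal r < h x}, hh.isOpen_preimage _⟩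

lemma mem_level (h : X → ℝ≥0∞) (hh : LowerSemicontinuous h) (r : ℝ) (x : X) :
    x ∈ level h hh r ↔ ENNReal.ofReal r < h x := Iff.rfl

/-- `∫ h dμ = ∫₀^∞ μ (h⁻¹ (r, ∞]) dr`. The integrand is antitone in `r`, so this Lebesgue integral is
the (improper) Riemann integral. -/
def integral (μ : ContValuation X) (h : X → ℝ≥0∞) (hh : LowerSemicontinuous h) : ℝ≥0∞ :=
  ∫⁻ r in Set.Ioi (0 : ℝ), μ (level h hh r)

/-- Dyadic lower sums. -/
def lowerSum (F : ℝ → ℝ≥0∞) (N : ℕ) : ℝ≥0∞ :=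
  (2⁻¹ : ℝ≥0∞) ^ N * ∑ k ∈ Finset.range (N * 2 ^ N), F (((k : ℝ) + 1) / 2 ^ N)

lemma lowerSum_mono {F : ℝ → ℝ≥0∞} (hF : Antitone F) : Monotone (lowerSum F) := by
  refine monotone_nat_of_le_succ fun N => ?_
  unfold lowerSum
  have h1 : ∀ n : ℕ, ∑ k ∈ Finset.range n, F (((k : ℝ) + 1) / 2 ^ N) ≤
      2⁻¹ * ∑ k ∈ Finset.range (n * 2), F (((k : ℝ) + 1) / 2 ^ (N + 1)) := by
    intro n
    induction n with
    | zero => simp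
    | succ n ih =>
      rw [Finset.sum_range_succ, show (n + 1) * 2 = n * 2 + 1 + 1 by ring,
        Finset.sum_range_succ, Finset.sum_range_succ, add_assoc, mul_add]
      refine add_le_add ih ?_
      have e2 : F (((n : ℝ) + 1) / 2 ^ N) ≤ F ((((n * 2 : ℕ) : ℝ) + 1) / 2 ^ (N + 1)) := by
        apply hF
        rw [pow_succ, div_le_div_iff₀ (by positivity) (by positivity)]
        push_cast
        have : (0 : ℝ) < 2 ^ N := by positivity
        nlinarith
      have e3 : F (((n : ℝ) + 1) / 2 ^ N) ≤ F ((((n * 2 + 1 : ℕ) : ℝ) + 1) / 2 ^ (N + 1)) := by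
        apply hF
        rw [pow_succ, div_le_div_iff₀ (by positivity) (by positivity)]
        push_cast
        have : (0 : ℝ) < 2 ^ N := by positivity
        nlinarith
      calc F (((n : ℝ) + 1) / 2 ^ N)
          = 2⁻¹ * (F (((n : ℝ) + 1) / 2 ^ N) + F (((n : ℝ) + 1) / 2 ^ N)) := by
            rw [← two_mul, ← mul_assoc, ENNReal.inv_mul_cancel (by simp) (by simp), one_mul]
        _ ≤ _ := by gcongr
  calc _ ≤ (2⁻¹ : ℝ≥0∞) ^ N * (2⁻¹ * ∑ k ∈ Finset.range (N * 2 ^ N * 2),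
        F (((k : ℝ) + 1) / 2 ^ (N + 1))) := by gcongr; exact h1 _
    _ ≤ _ := by
      rw [← mul_assoc, ← pow_succ]
      refine mul_le_mul_right (Finset.sum_le_sum_of_subset (Finset.range_mono ?_)) _
      rw [pow_succ, ← mul_assoc]
      gcongr
      omega

lemma iSup_lowerSum {F : ℝ → ℝ≥0∞} (hF : Antitone F)
    (hr : ∀ r > 0, ∀ a < F r, ∃ s > r, a < F s) :
    ⨆ N, lowerSum F N = ∫⁻ r in Set.Ioi (0 : ℝ), F r := by
  set f : ℕ → ℝ → ℝ≥0∞ := fun N r => ∑ k ∈ Finset.range (N * 2 ^ N),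
    (Set.Ico ((k : ℝ) / 2 ^ N) (((k : ℝ) + 1) / 2 ^ N)).indicator
      (fun _ => F (((k : ℝ) + 1) / 2 ^ N)) r with hf
  have hmeas : ∀ N, Measurable (f N) := fun N =>
    Finset.measurable_sum _ fun k _ => measurable_const.indicator measurableSet_Ico
  -- value of the step function on the dyadic interval
  have hval : ∀ N : ℕ, ∀ r : ℝ, 0 < r → r < N →
      f N r = F (((⌊r * 2 ^ N⌋₊ : ℝ) + 1) / 2 ^ N) := by
    intro N r h0 hN
    have hp : (0 : ℝ) < 2 ^ N := by positivity
    have hk := Nat.floor_le (show 0 ≤ r * 2 ^ N by positivity)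
    have hk' := Nat.lt_floor_add_one (r * 2 ^ N)
    rw [hf]
    dsimp only
    rw [Finset.sum_eq_single ⌊r * 2 ^ N⌋₊]
    · rw [Set.indicator_of_mem]
      exact ⟨by rwa [div_le_iff₀ hp], by rwa [lt_div_iff₀ hp]⟩
    · intro b _ hb
      rw [Set.indicator_of_notMem]
      rintro ⟨h1, h2⟩
      rw [div_le_iff₀ hp] at h1
      rw [lt_div_iff₀ hp] at h2
      exact hb ((Nat.floor_eq_iff (by positivity)).2 ⟨h1, h2⟩).symm
    · intro hn
      exfalso
      apply hn
      rw [Finset.mem_range, Nat.floor_lt (by positivity)]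
      push_cast
      gcongr
  have hzero : ∀ N : ℕ, ∀ r : ℝ, (N : ℝ) ≤ r → f N r = 0 := by
    intro N r h
    have hp : (0 : ℝ) < 2 ^ N := by positivity
    refine Finset.sum_eq_zero fun k hk => ?_
    rw [Set.indicator_of_notMem]
    rintro ⟨-, h2⟩
    rw [lt_div_iff₀ hp] at h2
    have h3 : ((k + 1 : ℕ) : ℝ) ≤ ((N * 2 ^ N : ℕ) : ℝ) := by
      exact_mod_cast Finset.mem_range.1 hk
    push_cast at h3
    nlinarith
  have hint : ∀ N, ∫⁻ r in Set.Ioi (0 : ℝ), f N r = lowerSum F N := by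
    intro N
    have hp : (0 : ℝ) < 2 ^ N := by positivity
    rw [hf, setLIntegral_congr (Ioi_ae_eq_Ici (μ := volume) (a := (0 : ℝ)))]
    dsimp only
    rw [lintegral_finsetSum _ fun k _ => measurable_const.indicator measurableSet_Ico]
    unfold lowerSum
    rw [Finset.mul_sum]
    refine Finset.sum_congr rfl fun k _ => ?_
    rw [lintegral_indicator measurableSet_Ico, lintegral_const, Measure.restrict_apply_univ,
      Measure.restrict_apply measurableSet_Ico, Set.inter_eq_left.2, Real.volume_Ico, mul_comm]
    · congr 1
      rw [← sub_div, add_sub_cancel_left, ENNReal.ofReal_div_of_pos hp, ENNReal.ofReal_one,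
        ENNReal.ofReal_pow (by norm_num), ENNReal.ofReal_ofNat, one_div, ENNReal.inv_pow]
    · intro r hr
      exact le_trans (by positivity) hr.1
  apply le_antisymm
  · refine iSup_le fun N => ?_
    rw [← hint]
    refine setLIntegral_mono' measurableSet_Ioi fun r h0 => ?_
    rcases lt_or_ge r N with h | h
    · rw [hval N r h0 h]
      refine hF ?_
      rw [le_div_iff₀ (by positivity)]
      exact (Nat.lt_floor_add_one _).le
    · rw [hzero N r h]; exact zero_le
  · calc ∫⁻ r in Set.Ioi (0 : ℝ), F r
        ≤ ∫⁻ r in Set.Ioi (0 : ℝ), Filter.liminf (fun N => f N r) Filter.atTop := by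
          refine setLIntegral_mono' measurableSet_Ioi fun r h0 => ?_
          refine le_of_forall_lt fun a ha => ?_
          obtain ⟨b, hab, hb⟩ := exists_between ha
          refine lt_of_lt_of_le hab (Filter.le_liminf_of_le (by isBoundedDefault) ?_)
          obtain ⟨s, hs, hbs⟩ := hr r h0 b hb
          obtain ⟨n, hn⟩ := exists_nat_gt r
          obtain ⟨m, hm⟩ := exists_pow_lt_of_lt_one (sub_pos.2 hs)
            (show (2⁻¹ : ℝ) < 1 by norm_num)
          filter_upwards [Filter.eventually_ge_atTop n, Filter.eventually_ge_atTop m] with N hN hM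
          have hp : (0 : ℝ) < 2 ^ N := by positivity
          rw [hval N r h0 (hn.trans_le (by exact_mod_cast hN))]
          refine hbs.le.trans (hF ?_)
          have h4 : (2⁻¹ : ℝ) ^ N ≤ 2⁻¹ ^ m :=
            pow_le_pow_of_le_one (by norm_num) (by norm_num) hM
          have h5 := Nat.floor_le (show 0 ≤ r * 2 ^ N from by have : (0:ℝ) < r := h0; positivity)
          rw [div_le_iff₀ hp]
          have h6 : (2⁻¹ : ℝ) ^ N * 2 ^ N = 1 := by rw [← mul_pow]; norm_num
          nlinarith
      _ ≤ Filter.liminf (fun N => ∫⁻ r in Set.Ioi (0 : ℝ), f N r) Filter.atTop :=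
          lintegral_liminf_le hmeas
      _ ≤ ⨆ N, lowerSum F N := by
          simp_rw [hint]
          refine Filter.liminf_le_of_le (by isBoundedDefault) fun b hb => ?_
          obtain ⟨N, hN⟩ := hb.exists
          exact hN.trans (le_iSup _ N)

lemma level_antitone (h : X → ℝ≥0∞) (hh : LowerSemicontinuous h) : Antitone (level h hh) :=
  fun _ _ hrs _ hx => lt_of_le_of_lt (ENNReal.ofReal_le_ofReal hrs) hx

lemma apply_level_antitone (μ : ContValuation X) (h : X → ℝ≥0∞) (hh : LowerSemicontinuous h) :
    Antitone (fun r => μ (level h hh r)) :=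
  fun _ _ hrs => μ.monotone (level_antitone h hh hrs)

lemma apply_level_right (μ : ContValuation X) (h : X → ℝ≥0∞) (hh : LowerSemicontinuous h) :
    ∀ r > 0, ∀ a < μ (level h hh r), ∃ s > r, a < μ (level h hh s) := by
  intro r hr a ha
  have hle : level h hh r ≤ ⨆ n : ℕ, level h hh (r + 1 / ((n : ℝ) + 1)) := by
    intro x hx
    obtain ⟨s, hs1, hs2⟩ := ENNReal.lt_iff_exists_nnreal_btwn.1 (show ENNReal.ofReal r < h x from hx)
    have hs3 : r < s := by
      rw [← ENNReal.ofReal_coe_nnreal] at hs1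
      exact (ENNReal.ofReal_lt_ofReal_iff_of_nonneg hr.le).1 hs1
    obtain ⟨n, hn⟩ := exists_nat_one_div_lt (sub_pos.2 hs3)
    refine Opens.mem_iSup.2 ⟨n, lt_of_le_of_lt ?_ hs2⟩
    rw [← ENNReal.ofReal_coe_nnreal]
    exact ENNReal.ofReal_le_ofReal (by linarith)
  have hmono : Monotone (fun n : ℕ => level h hh (r + 1 / ((n : ℝ) + 1))) := by
    intro m n hmn
    refine level_antitone h hh ?_
    gcongr
  have h2 := lt_of_lt_of_le ha (μ.monotone hle)
  rw [μ.map_iSup _ hmono.directed_le] at h2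
  obtain ⟨n, hn⟩ := lt_iSup_iff.1 h2
  exact ⟨_, by simp; positivity, hn⟩

lemma integral_eq_iSup (μ : ContValuation X) (h : X → ℝ≥0∞) (hh : LowerSemicontinuous h) :
    integral μ h hh = ⨆ N, lowerSum (fun r => μ (level h hh r)) N :=
  (iSup_lowerSum (apply_level_antitone μ h hh) (apply_level_right μ h hh)).symm

lemma integral_congr {μ : ContValuation X} {h k : X → ℝ≥0∞} {hh : LowerSemicontinuous h}
    (hk : LowerSemicontinuous k) (e : ∀ x, h x = k x) : integral μ h hh = integral μ k hk := by
  obtain rfl : h = k := funext e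
  rfl

lemma integral_mono (μ : ContValuation X) {h k : X → ℝ≥0∞} {hh : LowerSemicontinuous h}
    {hk : LowerSemicontinuous k} (e : ∀ x, h x ≤ k x) : integral μ h hh ≤ integral μ k hk :=
  lintegral_mono fun _ => μ.monotone fun x (hx : _ < _) => lt_of_lt_of_le hx (e x)

lemma integral_iSup (μ : ContValuation X) {ι : Type*} [Nonempty ι] (h : ι → X → ℝ≥0∞)
    (hh : ∀ i, LowerSemicontinuous (h i)) (hd : Directed (· ≤ ·) h)
    (hs : LowerSemicontinuous (fun x => ⨆ i, h i x)) :
    integral μ (fun x => ⨆ i, h i x) hs = ⨆ i, integral μ (h i) (hh i) := by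
  simp_rw [integral_eq_iSup]
  rw [iSup_comm]
  refine iSup_congr fun N => ?_
  unfold lowerSum
  rw [← ENNReal.mul_iSup]
  congr 1
  have hl : ∀ r, Directed (· ≤ ·) (fun i => level (h i) (hh i) r) := fun r i j =>
    (hd i j).imp fun k hk => ⟨fun x (hx : _ < _) => lt_of_lt_of_le hx (hk.1 x),
      fun x (hx : _ < _) => lt_of_lt_of_le hx (hk.2 x)⟩
  have he : ∀ r, level (fun x => ⨆ i, h i x) hs r = ⨆ i, level (h i) (hh i) r := by
    intro r
    ext x
    simp [mem_level, lt_iSup_iff]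
  simp_rw [he, fun r => μ.map_iSup _ (hl r)]
  refine ENNReal.finsetSum_iSup fun i j => ?_
  obtain ⟨k, hk⟩ := hd i j
  exact ⟨k, fun a => ⟨μ.monotone fun x (hx : _ < _) => lt_of_lt_of_le hx (hk.1 x),
    μ.monotone fun x (hx : _ < _) => lt_of_lt_of_le hx (hk.2 x)⟩⟩

lemma integral_dirac (x : X) (h : X → ℝ≥0∞) (hh : LowerSemicontinuous h) :
    integral (dirac x) h hh = h x := by
  classical
  unfold integral
  have e : ∀ r : ℝ, dirac x (level h hh r) =
      {r : ℝ | ENNReal.ofReal r < h x}.indicator (fun _ => 1) r := by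
    intro r
    rw [dirac_apply, Set.indicator_apply]
    congr
  have hm : MeasurableSet {r : ℝ | ENNReal.ofReal r < h x} :=
    measurableSet_lt ENNReal.measurable_ofReal measurable_const
  simp_rw [e]
  rw [lintegral_indicator hm, lintegral_const, Measure.restrict_apply_univ,
    Measure.restrict_apply hm, one_mul]
  rcases eq_or_ne (h x) ∞ with hx | hx
  · simp [hx]
  · have : {r : ℝ | ENNReal.ofReal r < h x} ∩ Set.Ioi 0 = Set.Ioo 0 (h x).toReal := by
      ext r
      refine and_comm.trans (and_congr_right fun h0 : 0 < r => ?_)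
      exact ENNReal.ofReal_lt_iff_lt_toReal h0.le hx
    rw [this, Real.volume_Ioo, sub_zero, ENNReal.ofReal_toReal hx]

lemma lowerSemicontinuous_dirac (U : Opens X) :
    LowerSemicontinuous (fun x : X => dirac x U) := by
  classical
  have : (fun x : X => dirac x U) = (U : Set X).indicator (fun _ => 1) := by
    funext x
    rw [dirac_apply, Set.indicator_apply]
    rfl
  rw [this]
  exact U.isOpen.lowerSemicontinuous_indicator zero_le_one

lemma lowerSemicontinuous_const_mul {h : X → ℝ≥0∞} (hh : LowerSemicontinuous h) (c : ℝ≥0∞)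
    (hc : c ≠ ∞) : LowerSemicontinuous (fun x => c * h x) :=
  (ENNReal.continuous_const_mul hc).comp_lowerSemicontinuous hh fun _ _ h => mul_le_mul_right h c

lemma integral_add_indicator (μ : ContValuation X) (h : X → ℝ≥0∞) (hh : LowerSemicontinuous h)
    (c : ℝ) (hc : 0 < c) (U : Opens X)
    (hk : LowerSemicontinuous (fun x => h x + ENNReal.ofReal c * dirac x U)) :
    integral μ (fun x => h x + ENNReal.ofReal c * dirac x U) hk =
      integral μ h hh + ENNReal.ofReal c * μ U := by
  classical
  set G : ℝ → ℝ≥0∞ := fun r => if r < c then μ U else μ (U ⊓ level h hh (r - c)) with hG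
  set W : ℝ → ℝ≥0∞ := fun r => μ (U ⊓ level h hh r) with hW
  have hWa : Antitone W := fun r s hrs =>
    μ.monotone (inf_le_inf_left _ (level_antitone h hh hrs))
  have key : ∀ r ∈ Set.Ioi (0 : ℝ), μ (level _ hk r) + W r = μ (level h hh r) + G r := by
    intro r hr
    rw [hG, hW]
    dsimp only
    split_ifs with hrc
    · have e : level _ hk r = level h hh r ⊔ U := by
        ext x
        by_cases hx : x ∈ U
        · have h1 : ENNReal.ofReal r < h x + ENNReal.ofReal c :=
            lt_of_lt_of_le ((ENNReal.ofReal_lt_ofReal_iff hc).2 hrc) le_add_self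
          simpa [mem_level, dirac_apply, hx] using h1
        · simp [mem_level, dirac_apply, hx]
      rw [e, inf_comm]
      exact (μ.modular _ _).symm
    · have hrc := not_lt.1 hrc
      have e : level _ hk r = level h hh r ⊔ (U ⊓ level h hh (r - c)) := by
        ext x
        by_cases hx : x ∈ U
        · have h1 : ENNReal.ofReal r < h x + ENNReal.ofReal c ↔
              ENNReal.ofReal (r - c) < h x := by
            rw [ENNReal.ofReal_sub _ hc.le, ENNReal.sub_lt_iff_lt_right ENNReal.ofReal_ne_top
              (ENNReal.ofReal_le_ofReal hrc)]
          have h2 : ENNReal.ofReal r < h x → ENNReal.ofReal (r - c) < h x := fun h3 =>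
            lt_of_le_of_lt (ENNReal.ofReal_le_ofReal (by linarith)) h3
          have h4 : ENNReal.ofReal r < h x + ENNReal.ofReal c ↔
              (ENNReal.ofReal r < h x ∨ ENNReal.ofReal (r - c) < h x) := by tauto
          simpa [mem_level, dirac_apply, hx] using h4
        · simp [mem_level, dirac_apply, hx]
      have e2 : U ⊓ level h hh r = level h hh r ⊓ (U ⊓ level h hh (r - c)) := by
        have := level_antitone h hh (show r - c ≤ r by linarith)
        rw [inf_left_comm, inf_eq_left.2 this]
      rw [e, e2]
      exact (μ.modular _ _).symm
  have hGint : ∫⁻ r in Set.Ioi (0 : ℝ), G r =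
      ENNReal.ofReal c * μ U + ∫⁻ r in Set.Ioi (0 : ℝ), W r := by
    have hu : Set.Ioi (0 : ℝ) = Set.Ioo 0 c ∪ Set.Ici c := (Set.Ioo_union_Ici_eq_Ioi hc).symm
    have hdisj : Disjoint (Set.Ioo 0 c) (Set.Ici c) :=
      Set.disjoint_left.2 fun r h1 h2 => absurd h1.2 (not_lt.2 h2)
    rw [hu, lintegral_union measurableSet_Ici hdisj, ← hu]
    congr 1
    · rw [setLIntegral_congr_fun (g := fun _ => μ U) measurableSet_Ioo
        (fun r hr => by simp [hG, hr.2])]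
      simp [mul_comm]
    · rw [setLIntegral_congr_fun (g := fun r => W (r - c)) measurableSet_Ici
        (fun r hr => by simp [hG, hW, not_lt.2 (show c ≤ r from hr)])]
      rw [setLIntegral_congr (Ioi_ae_eq_Ici (μ := volume) (a := (0 : ℝ))),
        ← lintegral_indicator measurableSet_Ici, ← lintegral_indicator measurableSet_Ici,
        ← lintegral_sub_right_eq_self ((Set.Ici 0).indicator _) c]
      refine lintegral_congr fun r => ?_
      simp [Set.indicator_apply]
  have hsum : integral μ _ hk + ∫⁻ r in Set.Ioi (0 : ℝ), W r =
      integral μ h hh + (ENNReal.ofReal c * μ U + ∫⁻ r in Set.Ioi (0 : ℝ), W r) := by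
    rw [← hGint]
    unfold integral
    rw [← lintegral_add_right _ hWa.measurable,
      ← lintegral_add_left (apply_level_antitone μ h hh).measurable]
    exact setLIntegral_congr_fun measurableSet_Ioi key
  by_cases hfin : ∫⁻ r in Set.Ioi (0 : ℝ), W r = ∞
  · have h1 : integral μ h hh = ∞ := by
      refine top_le_iff.1 (hfin ▸ ?_)
      exact lintegral_mono fun r => μ.monotone inf_le_right
    have h2 : integral μ _ hk = ∞ :=
      top_le_iff.1 (h1 ▸ integral_mono μ fun x => le_self_add)
    rw [h1, h2, top_add]
  · rw [← add_assoc] at hsum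
    exact (ENNReal.add_left_inj hfin).1 hsum

lemma integral_add_step (μ : ContValuation X) (h : X → ℝ≥0∞) (hh : LowerSemicontinuous h)
    (N : ℕ) (A : ℕ → Opens X) (n : ℕ)
    (hk : LowerSemicontinuous
      (fun x => h x + (2⁻¹ : ℝ≥0∞) ^ N * ∑ k ∈ Finset.range n, dirac x (A k))) :
    integral μ (fun x => h x + (2⁻¹ : ℝ≥0∞) ^ N * ∑ k ∈ Finset.range n, dirac x (A k)) hk =
      integral μ h hh + (2⁻¹ : ℝ≥0∞) ^ N * ∑ k ∈ Finset.range n, μ (A k) := by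
  induction n with
  | zero => simp
  | succ n ih =>
    have h2 : (2⁻¹ : ℝ≥0∞) ^ N ≠ ∞ := by simp
    have hc : (2⁻¹ : ℝ≥0∞) ^ N = ENNReal.ofReal (2⁻¹ ^ N) := by
      rw [ENNReal.ofReal_pow (by norm_num), ENNReal.ofReal_inv_of_pos (by norm_num),
        ENNReal.ofReal_ofNat]
    have hn : LowerSemicontinuous
        (fun x => h x + (2⁻¹ : ℝ≥0∞) ^ N * ∑ k ∈ Finset.range n, dirac x (A k)) :=
      hh.add (lowerSemicontinuous_const_mul
        (lowerSemicontinuous_sum fun k _ => lowerSemicontinuous_dirac (A k)) _ h2)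
    have hn' := hn.add (lowerSemicontinuous_const_mul (lowerSemicontinuous_dirac (A n)) _ h2)
    rw [integral_congr hn' fun x => by rw [Finset.sum_range_succ, mul_add, add_assoc]]
    simp only [Finset.sum_range_succ, mul_add, ← add_assoc]
    rw [← ih hn]
    have hg : LowerSemicontinuous (fun x => (h x + (2⁻¹ : ℝ≥0∞) ^ N *
        ∑ k ∈ Finset.range n, dirac x (A k)) + ENNReal.ofReal (2⁻¹ ^ N) * dirac x (A n)) := by
      rw [← hc]; exact hn'
    have := integral_add_indicator μ _ hn (2⁻¹ ^ N) (by positivity) (A n) hg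
    simp only [← hc] at this
    exact this

lemma lowerSemicontinuous_lowerSum (k : X → ℝ≥0∞) (hk : LowerSemicontinuous k) (N : ℕ) :
    LowerSemicontinuous (fun x => lowerSum (fun r => dirac x (level k hk r)) N) :=
  lowerSemicontinuous_const_mul
    (lowerSemicontinuous_sum fun _ _ => lowerSemicontinuous_dirac _) _ (by simp)

lemma integral_add (μ : ContValuation X) (h k : X → ℝ≥0∞) (hh : LowerSemicontinuous h)
    (hk : LowerSemicontinuous k) (hhk : LowerSemicontinuous (fun x => h x + k x)) :
    integral μ (fun x => h x + k x) hhk = integral μ h hh + integral μ k hk := by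
  have e : ∀ x, h x + k x = ⨆ N, (h x + lowerSum (fun r => dirac x (level k hk r)) N) := by
    intro x
    rw [← ENNReal.add_iSup, ← integral_eq_iSup, integral_dirac]
  have hl : ∀ N, LowerSemicontinuous
      (fun x => h x + lowerSum (fun r => dirac x (level k hk r)) N) := fun N =>
    hh.add (lowerSemicontinuous_lowerSum k hk N)
  have hmono : Monotone (fun (N : ℕ) (x : X) =>
      h x + lowerSum (fun r => dirac x (level k hk r)) N) := fun M N hMN x =>
    add_le_add le_rfl (lowerSum_mono (apply_level_antitone (dirac x) k hk) hMN)
  rw [integral_congr (lowerSemicontinuous_iSup hl) e,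
    integral_iSup μ _ hl hmono.directed_le, integral_eq_iSup μ k hk, ENNReal.add_iSup]
  exact iSup_congr fun N => integral_add_step μ h hh N _ _ (hl N)

lemma integral_zero (μ : ContValuation X) (hz : LowerSemicontinuous (fun _ : X => (0 : ℝ≥0∞))) :
    integral μ (fun _ => 0) hz = 0 := by
  unfold integral
  have : ∀ r, level (fun _ : X => (0 : ℝ≥0∞)) hz r = ⊥ := by
    intro r; ext x; simp [level]
  simp_rw [this]
  have h0 : μ ⊥ = 0 := μ.strict
  simp [h0]

lemma integral_sum (μ : ContValuation X) (h : ℕ → X → ℝ≥0∞) (hh : ∀ k, LowerSemicontinuous (h k))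
    (n : ℕ) (hs : LowerSemicontinuous (fun x => ∑ k ∈ Finset.range n, h k x)) :
    integral μ (fun x => ∑ k ∈ Finset.range n, h k x) hs =
      ∑ k ∈ Finset.range n, integral μ (h k) (hh k) := by
  induction n with
  | zero => simpa using integral_zero μ _
  | succ n ih =>
    have hn : LowerSemicontinuous (fun x => ∑ k ∈ Finset.range n, h k x) :=
      lowerSemicontinuous_sum fun k _ => hh k
    rw [Finset.sum_range_succ, ← ih hn, ← integral_add μ _ _ hn (hh n) (hn.add (hh n))]
    exact integral_congr _ fun x => Finset.sum_range_succ _ _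

lemma integral_pow_mul (μ : ContValuation X) (N : ℕ) (h : X → ℝ≥0∞) (hh : LowerSemicontinuous h)
    (hN : LowerSemicontinuous (fun x => (2⁻¹ : ℝ≥0∞) ^ N * h x)) :
    integral μ (fun x => (2⁻¹ : ℝ≥0∞) ^ N * h x) hN = (2⁻¹ : ℝ≥0∞) ^ N * integral μ h hh := by
  induction N with
  | zero => simp
  | succ N ih =>
    have h1 := lowerSemicontinuous_const_mul hh ((2⁻¹ : ℝ≥0∞) ^ N) (by simp)
    have h22 : (2⁻¹ : ℝ≥0∞) * 2 = 1 := ENNReal.inv_mul_cancel (by simp) (by simp)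
    have e : integral μ _ h1 = integral μ _ hN + integral μ _ hN := by
      rw [← integral_add μ _ _ hN hN (hN.add hN)]
      refine integral_congr _ fun x => ?_
      rw [← two_mul, pow_succ', mul_assoc, ← mul_assoc 2, mul_comm 2, h22, one_mul]
    refine Eq.trans ?_ (congrArg (· * _) (pow_succ' _ _).symm)
    rw [mul_assoc, ← ih h1, e, ← two_mul, ← mul_assoc, h22, one_mul]

lemma lowerSemicontinuous_integral (h : X → ℝ≥0∞) (hh : LowerSemicontinuous h) :
    LowerSemicontinuous (fun μ : ContValuation X => integral μ h hh) := by
  simp_rw [integral_eq_iSup]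
  exact lowerSemicontinuous_iSup fun N => lowerSemicontinuous_const_mul
    (lowerSemicontinuous_sum fun _ _ => lowerSemicontinuous_eval _) _ (by simp)

lemma integral_map (f : C(X, Y)) (μ : ContValuation X) (h : Y → ℝ≥0∞)
    (hh : LowerSemicontinuous h) :
    integral (map f μ) h hh = integral μ (fun x => h (f x)) (hh.comp f.continuous) := rfl

/-- The integral of the characteristic function of `U`. -/
lemma integral_apply_dirac (μ : ContValuation X) (U : Opens X) :
    integral μ (fun x => dirac x U) (lowerSemicontinuous_dirac U) = μ U := by
  have hz : LowerSemicontinuous (fun _ : X => (0 : ℝ≥0∞)) := lowerSemicontinuous_const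
  have hl := hz.add (lowerSemicontinuous_const_mul (lowerSemicontinuous_dirac U)
    (ENNReal.ofReal 1) (by simp))
  have h := integral_add_indicator μ (fun _ => 0) hz 1 one_pos U hl
  rw [integral_zero, zero_add] at h
  calc _ = _ := integral_congr hl fun x => by simp
    _ = _ := h
    _ = μ U := by simp

/-! ### The monad -/

lemma lowerSemicontinuous_apply (f : C(X, ContValuation Y)) (U : Opens Y) :
    LowerSemicontinuous (fun x => f x U) :=
  (lowerSemicontinuous_eval U).comp f.continuous

/-- The extension `f†` of `f : X → V Y`, given by `f† μ U = ∫ f x U dμ(x)`. -/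
def bind (f : C(X, ContValuation Y)) (μ : ContValuation X) : ContValuation Y where
  toFun U := integral μ (fun x => f x U) (lowerSemicontinuous_apply f U)
  strict := by
    rw [integral_congr lowerSemicontinuous_const fun x => (f x).apply_bot]
    exact integral_zero μ _
  mono U V h := integral_mono μ fun x => (f x).monotone h
  modular U V := by
    have l := lowerSemicontinuous_apply f
    rw [← integral_add μ _ _ (l U) (l V) ((l U).add (l V)),
      ← integral_add μ _ _ (l (U ⊔ V)) (l (U ⊓ V)) ((l (U ⊔ V)).add (l (U ⊓ V)))]
    exact integral_congr _ fun x => (f x).modular U V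
  scott := by
    refine scottContinuous_of_iSup (fun U V h => integral_mono μ fun x => (f x).monotone h) ?_
    intro d hd hd'
    have l := fun i : d => lowerSemicontinuous_apply f (i : Opens Y)
    rw [integral_congr (lowerSemicontinuous_iSup l) fun x => (f x).map_iSup _ hd']
    refine le_of_eq (integral_iSup μ _ l (fun i j => ?_) _)
    exact (hd' i j).imp fun k hk => ⟨fun x => (f x).monotone hk.1, fun x => (f x).monotone hk.2⟩

lemma bind_apply (f : C(X, ContValuation Y)) (μ : ContValuation X) (U : Opens Y) :
    bind f μ U = integral μ (fun x => f x U) (lowerSemicontinuous_apply f U) := rfl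

lemma continuous_bind (f : C(X, ContValuation Y)) : Continuous (bind f) :=
  continuous_of_lowerSemicontinuous fun _ => lowerSemicontinuous_integral _ _

lemma continuous_map (f : C(X, Y)) : Continuous (map f) :=
  continuous_of_lowerSemicontinuous fun U => lowerSemicontinuous_eval (U.comap f)

lemma continuous_dirac : Continuous (dirac : X → ContValuation X) :=
  continuous_of_lowerSemicontinuous lowerSemicontinuous_dirac

/-- The disintegration formula. -/
lemma integral_bind (f : C(X, ContValuation Y)) (μ : ContValuation X) (h : Y → ℝ≥0∞)
    (hh : LowerSemicontinuous h) :
    integral (bind f μ) h hh = integral μ (fun x => integral (f x) h hh)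
      ((lowerSemicontinuous_integral h hh).comp f.continuous) := by
  have l := lowerSemicontinuous_apply f
  have ls : ∀ N : ℕ, LowerSemicontinuous (fun x => ∑ k ∈ Finset.range (N * 2 ^ N),
      f x (level h hh (((k : ℝ) + 1) / 2 ^ N))) := fun N => lowerSemicontinuous_sum fun k _ => l _
  have lN : ∀ N, LowerSemicontinuous (fun x => lowerSum (fun r => f x (level h hh r)) N) :=
    fun N => lowerSemicontinuous_const_mul (ls N) _ (by simp)
  have hmono : Monotone (fun (N : ℕ) (x : X) => lowerSum (fun r => f x (level h hh r)) N) :=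
    fun M N hMN x => lowerSum_mono (apply_level_antitone (f x) h hh) hMN
  rw [integral_congr (lowerSemicontinuous_iSup lN) fun x => integral_eq_iSup (f x) h hh,
    integral_iSup μ _ lN hmono.directed_le, integral_eq_iSup]
  refine iSup_congr fun N => ?_
  refine Eq.trans ?_ (integral_pow_mul μ N _ (ls N) (lN N)).symm
  rw [integral_sum μ _ (fun k => l _)]
  rfl

/-- The multiplication `m ϖ U = ∫ ν U dϖ(ν)`. -/
def join (ϖ : ContValuation (ContValuation X)) : ContValuation X :=
  bind (ContinuousMap.id (ContValuation X)) ϖ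

lemma join_apply (ϖ : ContValuation (ContValuation X)) (U : Opens X) :
    join ϖ U = integral ϖ (fun ν => ν U) (lowerSemicontinuous_eval U) := rfl

lemma join_map_join (Ξ : ContValuation (ContValuation (ContValuation X))) :
    join (map ⟨join, continuous_bind _⟩ Ξ) = join (join Ξ) :=
  ContValuation.ext_opens fun U => (integral_bind
    (ContinuousMap.id (ContValuation (ContValuation X))) Ξ _ (lowerSemicontinuous_eval U)).symm

lemma join_dirac (μ : ContValuation X) : join (dirac μ) = μ :=
  ContValuation.ext_opens fun U => integral_dirac μ _ (lowerSemicontinuous_eval U)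

lemma join_map_dirac (μ : ContValuation X) :
    join (map ⟨dirac, continuous_dirac⟩ μ) = μ :=
  ContValuation.ext_opens fun U => integral_apply_dirac μ U

/-- The category of `T₀` spaces and continuous maps. -/
abbrev TopT0 : Type (u + 1) :=
  ObjectProperty.FullSubcategory (fun X : TopCat.{u} => T0Space X)

/-- The valuation powerdomain functor on `T₀` spaces. -/
def valuationFunctor : TopT0.{u} ⥤ TopT0.{u} where
  obj X := ⟨TopCat.of (ContValuation X.obj), inferInstanceAs (T0Space (ContValuation X.obj))⟩
  map f := ObjectProperty.homMk (TopCat.ofHom ⟨map f.hom.hom, continuous_map f.hom.hom⟩)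

/-- The extended probabilistic powerdomain monad on `T₀` spaces. -/
def valuationMonad : CategoryTheory.Monad TopT0.{u} where
  toFunctor := valuationFunctor
  η := { app := fun X => ObjectProperty.homMk (TopCat.ofHom ⟨dirac, continuous_dirac⟩) }
  μ := { app := fun X => ObjectProperty.homMk (TopCat.ofHom ⟨join, continuous_bind _⟩) }
  assoc X := by
    ext Ξ
    exact join_map_join (X := X.obj) Ξ
  left_unit X := by
    ext μ
    exact join_dirac (X := X.obj) μ
  right_unit X := by
    ext μ
    exact join_map_dirac (X := X.obj) μ

/-- The underlying space of an Eilenberg-Moore algebra of the valuation monad. -/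
abbrev carrier (A : valuationMonad.{u}.Algebra) : Type u := A.A.obj

/-- The structure map of an Eilenberg-Moore algebra of the valuation monad. -/
def structureMap (A : valuationMonad.{u}.Algebra) : ContValuation (carrier A) → carrier A :=
  fun μ => A.a.hom.hom μ

/-! ### Topological cones

A cone is a module over the semiring `ℝ≥0` of nonnegative reals. -/

/-- A topological cone: the topology is `T₀`, and addition and scalar multiplication are jointly
continuous, where the scalars carry the Scott topology. -/
structure IsTopologicalCone (C : Type u) [TopologicalSpace C] [AddCommMonoid C]
    [Module ℝ≥0 C] : Prop where
  t0 : T0Space C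
  continuous_add : Continuous fun p : C × C => p.1 + p.2
  continuous_smul :
    Continuous fun p : Topology.WithScott ℝ≥0 × C => Topology.WithScott.ofScott p.1 • p.2

/-- Every open neighbourhood of a point contains a (not necessarily open) convex neighbourhood. -/
def IsWeaklyLocallyConvex (C : Type u) [TopologicalSpace C] [AddCommMonoid C]
    [Module ℝ≥0 C] : Prop :=
  ∀ (x : C) (U : Set C), IsOpen U → x ∈ U → ∃ N ∈ 𝓝 x, Convex ℝ≥0 N ∧ N ⊆ U

/-- A half-space is a convex set with convex complement. -/
def IsHalfSpace {C : Type u} [AddCommMonoid C] [Module ℝ≥0 C] (H : Set C) : Prop :=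
  Convex ℝ≥0 H ∧ Convex ℝ≥0 Hᶜ

/-- The topology has a subbase of open half-spaces. -/
def IsLocallyLinear (C : Type u) [t : TopologicalSpace C] [AddCommMonoid C]
    [Module ℝ≥0 C] : Prop :=
  ∃ B : Set (Set C), (∀ H ∈ B, IsHalfSpace H) ∧ t = TopologicalSpace.generateFrom B

/-- A space is sober if every irreducible closed set is the closure of a unique point. -/
def IsSober (C : Type u) [TopologicalSpace C] : Prop :=
  ∀ S : Set C, IsIrreducible S → IsClosed S → ∃! x, closure {x} = S

/-- A linear retraction: a continuous linear map with a continuous section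
(the section need not be linear). -/
def IsLinearRetraction {C D : Type u} [TopologicalSpace C] [AddCommMonoid C] [Module ℝ≥0 C]
    [TopologicalSpace D] [AddCommMonoid D] [Module ℝ≥0 D] (r : C → D) : Prop :=
  Continuous r ∧ IsLinearMap ℝ≥0 r ∧ ∃ s : D → C, Continuous s ∧ ∀ y, r (s y) = y

end

end ProbPowerdomain

namespace ProbPowerdomain

/-!
The cone `V X` is a sober, locally linear topological cone because its topology is generated by the
sets `{μ | r < μ U}`, with `μ ↦ μ U` linear and lower semicontinuous. The generic point of an
irreducible closed set of valuations is its pointwise supremum, which is modular since the supremum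
over an irreducible set of a sum of two lower semicontinuous functions is the sum of the suprema.

Since `join` and `map α` are linear, the law `α ∘ map α = α ∘ join` says that `μ + ν` and `r • μ`
are sent by `α` to elements which depend only on `α μ` and `α ν`. Hence `α` transports the cone
structure of `V X` to `X`, and it is a linear retraction with section `dirac`. The three topological
properties of `X` are inherited by linear retracts.
-/

section Irreducible

variable {X : Type*} [TopologicalSpace X] {S : Set X}

lemma apply_le_biSup_diag {β : Type*} [CompleteLinearOrder β] (hS : IsPreirreducible S)
    {F : X × X → β} (hF : LowerSemicontinuous F) {x y : X} (hx : x ∈ S) (hy : y ∈ S) :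
    F (x, y) ≤ ⨆ z ∈ S, F (z, z) := by
  by_contra! hlt
  obtain ⟨U, V, hU, hV, hxU, hyV, hUV⟩ := isOpen_prod_iff.1 (hF.isOpen_preimage _) x y hlt
  -- The open rectangle `U ×ˢ V` around `(x, y)` meets the diagonal of `S`.
  obtain ⟨z, hzS, hzU, hzV⟩ := hS U V hU hV ⟨x, hx, hxU⟩ ⟨y, hy, hyV⟩
  have hz : (⨆ z ∈ S, F (z, z)) < F (z, z) := hUV (Set.mk_mem_prod hzU hzV)
  exact hz.not_ge (le_biSup (fun z => F (z, z)) hzS)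

lemma biSup_add_biSup_of_isIrreducible (hS : IsIrreducible S) {f g : X → ℝ≥0∞}
    (hf : LowerSemicontinuous f) (hg : LowerSemicontinuous g) :
    (⨆ x ∈ S, f x) + ⨆ x ∈ S, g x = ⨆ x ∈ S, (f x + g x) := by
  have hfg : LowerSemicontinuous fun p : X × X => f p.1 + g p.2 :=
    (hf.comp continuous_fst).add (hg.comp continuous_snd)
  apply le_antisymm
  · exact ENNReal.biSup_add_biSup_le hS.nonempty hS.nonempty fun x hx y hy =>
      apply_le_biSup_diag hS.isPreirreducible hfg hx hy
  · exact iSup₂_le fun x hx => add_le_add (le_biSup f hx) (le_biSup g hx)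

lemma isGenericPoint_of_generateFrom {B : Set (Set X)} (hB : ‹TopologicalSpace X› = generateFrom B)
    (hS : IsIrreducible S) (hc : IsClosed S) {x : X} (hx : ∀ H ∈ B, x ∈ H ↔ (S ∩ H).Nonempty) :
    IsGenericPoint x S := by
  have hopen : ∀ H ∈ B, IsOpen H := fun H hH => hB ▸ isOpen_generateFrom_of_mem hH
  have hxS : x ∈ S := by
    by_contra hxS
    obtain ⟨_, ⟨F, ⟨hF, hFB⟩, rfl⟩, hxF, hFS⟩ :=
      (isTopologicalBasis_of_subbasis hB).exists_subset_of_mem_open hxS hc.isOpen_compl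
    lift F to Finset (Set X) using hF
    obtain ⟨y, hyS, hyF⟩ := isIrreducible_iff_sInter.1 hS F (fun H hH => hopen H (hFB hH))
      fun H hH => (hx H (hFB hH)).1 (hxF H hH)
    exact hFS hyF hyS
  have hspec : ∀ y ∈ S, x ⤳ y := by
    intro y hy
    have hnhds : 𝓝 y = ⨅ H ∈ {H | y ∈ H ∧ H ∈ B}, Filter.principal H := hB ▸ nhds_generateFrom
    rw [Specializes, hnhds]
    exact le_iInf₂ fun H ⟨hyH, hH⟩ => Filter.le_principal_iff.2 <|
      (hopen H hH).mem_nhds ((hx H hH).2 ⟨y, hy, hyH⟩)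
  exact (closure_minimal (Set.singleton_subset_iff.2 hxS) hc).antisymm fun y hy =>
    (hspec y hy).mem_closure

end Irreducible

section Retract

variable {X Y : Type*} [TopologicalSpace X] [TopologicalSpace Y]

lemma quasiSober_of_leftInverse [QuasiSober X] {r : X → Y} {s : Y → X} (hr : Continuous r)
    (hs : Continuous s) (hrs : Function.LeftInverse r s) : QuasiSober Y where
  sober {S} hS hc := by
    obtain ⟨x, hx⟩ := QuasiSober.sober (hS.image s hs.continuousOn).closure isClosed_closure
    refine ⟨r x, ?_⟩
    simpa only [closure_image_closure hr, hrs.image_image, hc.closure_eq] using hx.image hr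

end Retract

section TopologicalCone

lemma isHalfSpace_preimage_Ioi {C β : Type*} [AddCommMonoid C] [Module ℝ≥0 C]
    [AddCommMonoid β] [LinearOrder β] [IsOrderedAddMonoid β] [Module ℝ≥0 β] [PosSMulMono ℝ≥0 β]
    {f : C → β} (hf : IsLinearMap ℝ≥0 f) (b : β) : IsHalfSpace (f ⁻¹' Set.Ioi b) := by
  refine ⟨Set.ordConnected_Ioi.convex.is_linear_preimage hf, ?_⟩
  rw [← Set.preimage_compl, Set.compl_Ioi]
  exact (convex_Iic b).is_linear_preimage hf

variable {C D : Type u} [TopologicalSpace C] [TopologicalSpace D]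

lemma isSober_iff : IsSober C ↔ T0Space C ∧ QuasiSober C := by
  constructor
  · intro h
    refine ⟨⟨fun x y hxy => ?_⟩, ⟨fun hS hc => (h _ hS hc).exists⟩⟩
    exact (h (closure {y}) isIrreducible_singleton.closure isClosed_closure).unique
      (inseparable_iff_closure_eq.1 hxy) rfl
  · rintro ⟨_, _⟩ S hS hc
    obtain ⟨x, hx⟩ := QuasiSober.sober hS hc
    exact ⟨x, hx, fun y hy => IsGenericPoint.eq hy hx⟩

variable [AddCommMonoid C] [Module ℝ≥0 C] [AddCommMonoid D] [Module ℝ≥0 D]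

lemma IsLocallyLinear.isWeaklyLocallyConvex (h : IsLocallyLinear C) : IsWeaklyLocallyConvex C := by
  obtain ⟨B, hB, ht⟩ := h
  intro x U hU hx
  have hbasis := isTopologicalBasis_of_subbasis ht
  obtain ⟨N, hN, hxN, hNU⟩ := hbasis.exists_subset_of_mem_open hx hU
  refine ⟨N, hbasis.mem_nhds hN hxN, ?_, hNU⟩
  obtain ⟨F, ⟨-, hFB⟩, rfl⟩ := hN
  exact convex_sInter fun H hH => (hB H (hFB hH)).1

namespace IsLinearRetraction

variable {r : C → D}

lemma isTopologicalCone (hr : IsLinearRetraction r) (hC : IsTopologicalCone C) :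
    IsTopologicalCone D := by
  obtain ⟨hcont, hlin, s, hs, hrs⟩ := hr
  have := hC.t0
  refine ⟨t0Space_of_injective_of_continuous (Function.LeftInverse.injective hrs) hs, ?_, ?_⟩
  · have hadd : (fun p : D × D => p.1 + p.2) = fun p => r (s p.1 + s p.2) := by
      simp only [hlin.map_add, hrs]
    rw [hadd]
    exact hcont.comp (hC.continuous_add.comp (hs.prodMap hs))
  · have hsmul : (fun p : Topology.WithScott ℝ≥0 × D => Topology.WithScott.ofScott p.1 • p.2) =
        fun p => r (Topology.WithScott.ofScott p.1 • s p.2) := by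
      simp only [hlin.map_smul, hrs]
    rw [hsmul]
    exact hcont.comp (hC.continuous_smul.comp (continuous_id.prodMap hs))

lemma isWeaklyLocallyConvex (hr : IsLinearRetraction r) (hC : IsWeaklyLocallyConvex C) :
    IsWeaklyLocallyConvex D := by
  obtain ⟨hcont, hlin, s, hs, hrs⟩ := hr
  intro y U hU hy
  obtain ⟨N, hN, hconv, hNU⟩ :=
    hC (s y) (r ⁻¹' U) (hU.preimage hcont) (by rwa [Set.mem_preimage, hrs])
  refine ⟨r '' N, ?_, hconv.is_linear_image hlin, Set.image_subset_iff.2 hNU⟩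
  exact Filter.mem_of_superset (hs.continuousAt hN) fun z hz => ⟨s z, hz, hrs z⟩

lemma isSober (hr : IsLinearRetraction r) (hC : IsSober C) : IsSober D := by
  obtain ⟨hcont, -, s, hs, hrs⟩ := hr
  obtain ⟨_, _⟩ := isSober_iff.1 hC
  exact isSober_iff.2 ⟨t0Space_of_injective_of_continuous (Function.LeftInverse.injective hrs) hs,
    quasiSober_of_leftInverse hcont hs hrs⟩

end IsLinearRetraction

end TopologicalCone

section LowerSemicontinuous

lemma lowerSemicontinuous_comp_ofScott {α β : Type*} [Preorder α] [LinearOrder β] {f : α → β}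
    (hf : ScottContinuous f) :
    LowerSemicontinuous fun a : Topology.WithScott α => f (Topology.WithScott.ofScott a) := by
  refine lowerSemicontinuous_iff_isClosed_preimage.2 fun b => ?_
  refine Topology.IsScott.isClosed_iff_isLowerSet_and_dirSupClosed.2 ⟨?_, ?_⟩
  · exact fun x y hyx hx => (hf.monotone hyx).trans hx
  · intro d hdb hne hdir a ha
    exact (hf hne hdir ha).2 (Set.forall_mem_image.2 hdb)

lemma scottContinuous_coe_ennreal : ScottContinuous ((↑) : ℝ≥0 → ℝ≥0∞) :=
  fun _ hne _ _ ha => ha.isLUB_of_tendsto (ENNReal.coe_mono.monotoneOn _) hne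
    ENNReal.continuous_coe.continuousWithinAt

lemma lowerSemicontinuous_mul {X : Type*} [TopologicalSpace X] {f g : X → ℝ≥0∞}
    (hf : LowerSemicontinuous f) (hg : LowerSemicontinuous g) :
    LowerSemicontinuous fun x => f x * g x := by
  intro x c hc
  obtain ⟨a, ha, b, hb, hab⟩ : ∃ a < f x, ∃ b < g x, c < a * b := by
    by_contra! h
    exact hc.not_ge (ENNReal.mul_le_of_forall_lt h)
  filter_upwards [hf x a ha, hg x b hb] with y hay hby
  exact hab.trans_le (mul_le_mul' hay.le hby.le)

end LowerSemicontinuous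

variable {X Y : Type u} [TopologicalSpace X] [TopologicalSpace Y]

section Linearity

lemma integral_add_valuation (μ ν : ContValuation X) (h : X → ℝ≥0∞) (hh : LowerSemicontinuous h) :
    integral (μ + ν) h hh = integral μ h hh + integral ν h hh :=
  lintegral_add_left (apply_level_antitone μ h hh).measurable _

lemma integral_smul_valuation (r : ℝ≥0) (μ : ContValuation X) (h : X → ℝ≥0∞)
    (hh : LowerSemicontinuous h) : integral (r • μ) h hh = r * integral μ h hh :=
  lintegral_const_mul' _ _ ENNReal.coe_ne_top

lemma isLinearMap_eval (U : Opens X) : IsLinearMap ℝ≥0 fun μ : ContValuation X => μ U where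
  map_add _ _ := rfl
  map_smul _ _ := rfl

lemma isLinearMap_map (f : C(X, Y)) : IsLinearMap ℝ≥0 (map f) where
  map_add _ _ := rfl
  map_smul _ _ := rfl

lemma isLinearMap_join :
    IsLinearMap ℝ≥0 (join : ContValuation (ContValuation X) → ContValuation X) where
  map_add ϖ ξ := ContValuation.ext_opens fun U =>
    integral_add_valuation ϖ ξ _ (lowerSemicontinuous_eval U)
  map_smul r ϖ := ContValuation.ext_opens fun U =>
    integral_smul_valuation r ϖ _ (lowerSemicontinuous_eval U)

lemma map_dirac (f : C(X, Y)) (x : X) : map f (dirac x) = dirac (f x) := rfl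

end Linearity

namespace ContValuation

lemma isTopologicalCone : IsTopologicalCone (ContValuation X) where
  t0 := inferInstance
  continuous_add := continuous_of_lowerSemicontinuous fun U =>
    ((lowerSemicontinuous_eval U).comp continuous_fst).add
      ((lowerSemicontinuous_eval U).comp continuous_snd)
  continuous_smul := continuous_of_lowerSemicontinuous fun U =>
    lowerSemicontinuous_mul
      ((lowerSemicontinuous_comp_ofScott scottContinuous_coe_ennreal).comp continuous_fst)
      ((lowerSemicontinuous_eval U).comp continuous_snd)

lemma isLocallyLinear : IsLocallyLinear (ContValuation X) := by
  refine ⟨_, ?_, rfl⟩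
  rintro _ ⟨U, r, rfl⟩
  exact isHalfSpace_preimage_Ioi (isLinearMap_eval U) (r : ℝ≥0∞)

/-- The pointwise supremum of an irreducible set of continuous valuations; it is the generic point
of the closure of that set. -/
noncomputable def irreducibleSup {S : Set (ContValuation X)} (hS : IsIrreducible S) :
    ContValuation X where
  toFun U := ⨆ ν ∈ S, ν U
  strict := by simp [apply_bot]
  mono _ _ h := iSup₂_mono fun ν _ => ν.monotone h
  modular U V := by
    have hadd (U V : Opens X) := biSup_add_biSup_of_isIrreducible hS
      (lowerSemicontinuous_eval U) (lowerSemicontinuous_eval V)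
    rw [hadd, hadd]
    exact biSup_congr fun ν _ => ν.modular U V
  scott := by
    refine scottContinuous_of_iSup (fun _ _ h => iSup₂_mono fun ν _ => ν.monotone h) ?_
    intro d _ hd
    refine iSup₂_le fun ν hν => (ν.map_iSup _ hd).trans_le ?_
    exact iSup_mono fun U => le_biSup (fun ν : ContValuation X => ν U) hν

lemma lt_irreducibleSup_apply_iff {S : Set (ContValuation X)} (hS : IsIrreducible S)
    {U : Opens X} {a : ℝ≥0∞} : a < irreducibleSup hS U ↔ ∃ ν ∈ S, a < ν U :=
  lt_biSup_iff

instance : QuasiSober (ContValuation X) where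
  sober {S} hS hc := by
    refine ⟨irreducibleSup hS, isGenericPoint_of_generateFrom rfl hS hc ?_⟩
    rintro _ ⟨U, r, rfl⟩
    exact lt_irreducibleSup_apply_iff hS

lemma isSober : IsSober (ContValuation X) :=
  isSober_iff.2 ⟨inferInstance, inferInstance⟩

end ContValuation

/-- `α` satisfies the two Eilenberg–Moore laws of the valuation monad. This is the unbundled form of
an algebra, on a space which is not assumed to be `T₀`. -/
structure IsAlgebra (α : C(ContValuation X, X)) : Prop where
  apply_dirac : ∀ x, α (dirac x) = x
  apply_map : ∀ ϖ, α (map α ϖ) = α (join ϖ)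

lemma isAlgebra_structureMap (A : valuationMonad.{u}.Algebra) :
    IsAlgebra (X := carrier A) A.a.hom.hom where
  apply_dirac x := congrArg (fun f => f.hom.hom x) A.unit
  apply_map ϖ := (congrArg (fun f => f.hom.hom ϖ) A.assoc).symm

namespace IsAlgebra

variable {α : C(ContValuation X, X)}

lemma surjective (h : IsAlgebra α) : Function.Surjective α :=
  Function.LeftInverse.surjective h.apply_dirac

lemma apply_add (h : IsAlgebra α) (μ ν : ContValuation X) :
    α (μ + ν) = α (dirac (α μ) + dirac (α ν)) :=
  calc α (μ + ν) = α (join (dirac μ + dirac ν)) := by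
        rw [isLinearMap_join.map_add, join_dirac, join_dirac]
    _ = α (map α (dirac μ + dirac ν)) := (h.apply_map _).symm
    _ = α (dirac (α μ) + dirac (α ν)) := by rw [(isLinearMap_map α).map_add, map_dirac, map_dirac]

lemma apply_smul (h : IsAlgebra α) (r : ℝ≥0) (μ : ContValuation X) :
    α (r • μ) = α (r • dirac (α μ)) :=
  calc α (r • μ) = α (join (r • dirac μ)) := by rw [isLinearMap_join.map_smul, join_dirac]
    _ = α (map α (r • dirac μ)) := (h.apply_map _).symm
    _ = α (r • dirac (α μ)) := by rw [(isLinearMap_map α).map_smul, map_dirac]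

/-- The addition `x + y = α (dirac x + dirac y)` on the carrier of an algebra. -/
noncomputable abbrev addCommMonoid (h : IsAlgebra α) : AddCommMonoid X :=
  letI : Zero X := ⟨α 0⟩
  letI : Add X := ⟨fun x y => α (dirac x + dirac y)⟩
  letI : SMul ℕ X := ⟨fun n x => α ((n : ℝ≥0) • dirac x)⟩
  h.surjective.addCommMonoid α rfl h.apply_add fun μ n => by
    rw [← Nat.cast_smul_eq_nsmul ℝ≥0, h.apply_smul]
    rfl

/-- The cone structure on the carrier of an algebra, with `r • x = α (r • dirac x)`. -/
noncomputable abbrev module (h : IsAlgebra α) : letI := h.addCommMonoid; Module ℝ≥0 X :=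
  letI := h.addCommMonoid
  letI : SMul ℝ≥0 X := ⟨fun r x => α (r • dirac x)⟩
  h.surjective.module ℝ≥0 { toFun := α, map_zero' := rfl, map_add' := h.apply_add } h.apply_smul

lemma isLinearMap (h : IsAlgebra α) :
    letI := h.addCommMonoid
    letI := h.module
    IsLinearMap ℝ≥0 α :=
  letI := h.addCommMonoid
  letI := h.module
  ⟨h.apply_add, h.apply_smul⟩

lemma isLinearRetraction (h : IsAlgebra α) :
    letI := h.addCommMonoid
    letI := h.module
    IsLinearRetraction α :=
  letI := h.addCommMonoid
  letI := h.module
  ⟨α.continuous, h.isLinearMap, dirac, continuous_dirac, h.apply_dirac⟩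

end IsAlgebra

end ProbPowerdomain

theorem mainTheorem1 (A : ProbPowerdomain.valuationMonad.{u}.Algebra) :
    ∃ (_ : AddCommMonoid (ProbPowerdomain.carrier A))
      (_ : Module ℝ≥0 (ProbPowerdomain.carrier A)),
      (∀ x y : ProbPowerdomain.carrier A,
        x + y = ProbPowerdomain.structureMap A
          (ProbPowerdomain.dirac x + ProbPowerdomain.dirac y)) ∧
      (∀ (r : ℝ≥0) (x : ProbPowerdomain.carrier A),
        r • x = ProbPowerdomain.structureMap A (r • ProbPowerdomain.dirac x)) ∧
      ProbPowerdomain.IsTopologicalCone (ProbPowerdomain.carrier A) ∧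
      ProbPowerdomain.IsWeaklyLocallyConvex (ProbPowerdomain.carrier A) ∧
      ProbPowerdomain.IsSober (ProbPowerdomain.carrier A) ∧
      IsLinearMap ℝ≥0 (ProbPowerdomain.structureMap A) ∧
      ProbPowerdomain.IsLinearRetraction (ProbPowerdomain.structureMap A) ∧
      ProbPowerdomain.IsTopologicalCone
        (ProbPowerdomain.ContValuation (ProbPowerdomain.carrier A)) ∧
      ProbPowerdomain.IsLocallyLinear
        (ProbPowerdomain.ContValuation (ProbPowerdomain.carrier A)) ∧
      ProbPowerdomain.IsSober
        (ProbPowerdomain.ContValuation (ProbPowerdomain.carrier A)) := by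
  have h := ProbPowerdomain.isAlgebra_structureMap A
  let _ := h.addCommMonoid
  let _ := h.module
  have hcone := ProbPowerdomain.ContValuation.isTopologicalCone (X := ProbPowerdomain.carrier A)
  have hlin := ProbPowerdomain.ContValuation.isLocallyLinear (X := ProbPowerdomain.carrier A)
  have hsober := ProbPowerdomain.ContValuation.isSober (X := ProbPowerdomain.carrier A)
  have hretr := h.isLinearRetraction
  exact ⟨h.addCommMonoid, h.module, fun _ _ => rfl, fun _ _ => rfl,
    hretr.isTopologicalCone hcone, hretr.isWeaklyLocallyConvex hlin.isWeaklyLocallyConvex,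
    hretr.isSober hsober, h.isLinearMap, hretr, hcone, hlin, hsober⟩
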